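/- For $a\in\mathbb{Q}$ and an integer $k\ge 0$ let $(a)_k=\prod_{j=0}^{k-1}(a+j)$. For every prime $p>3$, $$ \sum_{k=0}^{p-1}\frac{(\frac14)_k(\frac12)_k(\frac34)_k}{k!^3\,9^k}\,(8k+1)\equiv p\left(\frac{-3}{p}\right)\pmod{p^3}, $$ where $\left(\frac{-3}{p}\right)$ is the Jacobi–Kronecker symbol. The congruence is one between rational numbers whose denominators are prime to $p$: the difference of the two sides equals $p^3r$ for some rational number $r$ whose denominator is not divisible by $p$. -/

import Mathlib

/-- Congruence of rational numbers modulo a natural number `m`: `a ≡ b (mod m)` when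
`a - b = m * r` for some rational `r` whose denominator (in lowest terms) is coprime to `m`. -/
def RatModEq (m : ℕ) (a b : ℚ) : Prop :=
  ∃ r : ℚ, Nat.Coprime r.den m ∧ a - b = (m : ℚ) * r

/-- Pochhammer's symbol (shifted factorial) `(a)_k = a (a + 1) ⋯ (a + k - 1)`. -/
def pochhammer (a : ℚ) (k : ℕ) : ℚ :=
  ∏ j ∈ Finset.range k, (a + (j : ℚ))

/-! Deform the summand to `term u k`, which is the original one at `u = 0`, and write S(u) for its
sum over k < p. Two facts carry the proof. Exact value at u = p²: by a telescoping identity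
(`sum_term_shift_sub`), S(y²)/y is unchanged under y → y + 6 for suitable odd y, so S(p²) = ±p
follows from S(1) = 1 and S(25) = -5 (`sum_term_prime_sq`). Extra factor p: the numerator N(u) of
S(u) is divisible by p in ℤ[u] (`C_dvd_numerator`). Modulo p, y·N(y²) is invariant under y → y + 6
and has a double zero at 1, hence at all p residues, while its degree is at most 2p - 1. Hence N(p²)
≡ N(0) mod p³. The denominators at p² and 0 agree mod p², and S(p²) carries one more p, so S(0) ≡
S(p²) mod p³. -/

namespace RamanujanNine

open Finset

/-! ### Telescoping under the shift y → y + 6, over any field of characteristic not 2 -/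

section Telescoping

variable {K : Type*} [Field K]

/-- The product `∏_{j < k} ((2j + 1)² - u)`. -/
def oddProd {R : Type*} [CommRing R] (u : R) (k : ℕ) : R :=
  ∏ j ∈ range k, ((2 * (j : R) + 1) ^ 2 - u)

/-- The product `∏_{1 ≤ j ≤ k} (36 j² - u)`. -/
def sixProd {R : Type*} [CommRing R] (u : R) (k : ℕ) : R :=
  ∏ j ∈ range k, (36 * ((j : R) + 1) ^ 2 - u)

/-- The summand of the one-parameter deformation; `u = 0` gives the original summand. -/
def term (u : K) (k : ℕ) : K :=
  ((2 * k).centralBinom : K) * (8 * (k : K) + 1) * oddProd u k / (16 ^ k * sixProd u k)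

/-- The numerator `∏_{j < k} (2j + 1 + y)(2j - 5 - y)` common to the summands at `y` and `y + 6`. -/
def commonProd (y : K) (k : ℕ) : K :=
  ∏ j ∈ range k, ((2 * (j : K) + 1 + y) * (2 * (j : K) - 5 - y))

/-- The telescoping companion of `term`. -/
def companion (y : K) (n : ℕ) : K :=
  16 * ((n : K) * (2 * n - 1) * ((2 * n).centralBinom : K)) * (6 * n - y) * commonProd y n /
    (16 ^ n * (y * (y + 1) * (y + 5) * sixProd (y ^ 2) n))

theorem centralBinom_two_mul_succ (k : ℕ) :
    (2 * k + 1) * (2 * k + 2) * (2 * (k + 1)).centralBinom =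
      4 * (4 * k + 1) * (4 * k + 3) * (2 * k).centralBinom := by
  have h1 := Nat.succ_mul_centralBinom_succ (2 * k)
  have h2 := Nat.succ_mul_centralBinom_succ (2 * k + 1)
  rw [show 2 * (k + 1) = 2 * k + 1 + 1 by ring]
  calc _ = (2 * k + 1) * ((2 * k + 1 + 1) * (2 * k + 1 + 1).centralBinom) := by ring
    _ = 2 * (2 * (2 * k + 1) + 1) * ((2 * k + 1) * (2 * k + 1).centralBinom) := by rw [h2]; ring
    _ = _ := by rw [h1]; ring

/-- Keeping n(2n - 1) attached to the binomial means only 2 is cancelled; k + 1 and 2k + 1 may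
vanish in characteristic p. -/
theorem companion_coeff_succ (h2 : (2 : K) ≠ 0) (k : ℕ) :
    ((k + 1 : ℕ) : K) * (2 * ((k + 1 : ℕ) : K) - 1) * ((2 * (k + 1)).centralBinom : K) =
      2 * (4 * k + 1) * (4 * k + 3) * ((2 * k).centralBinom : K) := by
  have h := congrArg (Nat.cast : ℕ → K) (centralBinom_two_mul_succ k)
  push_cast at h ⊢
  apply mul_left_cancel₀ h2
  linear_combination h

/-- Each factor splits as (2j + 1 + y)(2j + 1 - y); moving the index of the second by three gives 2j
- 5 - y, leaving three boundary factors at each end. -/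
theorem oddProd_sq_mul (y : K) (k : ℕ) :
    oddProd (y ^ 2) k * (-((y + 1) * (y + 3) * (y + 5))) =
      commonProd y k * ((2 * k - 5 - y) * (2 * k - 3 - y) * (2 * k - 1 - y)) := by
  induction k with
  | zero => simp [oddProd, commonProd]; ring
  | succ k ih =>
    rw [oddProd, commonProd, prod_range_succ, prod_range_succ, ← oddProd, ← commonProd]
    push_cast
    linear_combination ((2 * (k : K) + 1) ^ 2 - y ^ 2) * ih

theorem oddProd_sq_shift_mul (y : K) (k : ℕ) :
    oddProd ((y + 6) ^ 2) k * ((y + 1) * (y + 3) * (y + 5)) =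
      commonProd y k * ((2 * k + 1 + y) * (2 * k + 3 + y) * (2 * k + 5 + y)) := by
  induction k with
  | zero => simp [oddProd, commonProd]; ring
  | succ k ih =>
    rw [oddProd, commonProd, prod_range_succ, prod_range_succ, ← oddProd, ← commonProd]
    push_cast
    linear_combination ((2 * (k : K) + 1) ^ 2 - (y + 6) ^ 2) * ih

theorem sixProd_sq_shift_mul {R : Type*} [CommRing R] (y : R) (k : ℕ) :
    sixProd ((y + 6) ^ 2) k * ((6 + y) * (6 * k - y)) =
      sixProd (y ^ 2) k * ((6 * k + 6 + y) * (-y)) := by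
  induction k with
  | zero => simp [sixProd]
  | succ k ih =>
    rw [sixProd, sixProd, prod_range_succ, prod_range_succ, ← sixProd, ← sixProd]
    push_cast
    linear_combination ((6 * (k : R) + 12 + y) * (6 * k + 6 - y)) * ih

theorem sixProd_sq_ne_zero {y : K} (hs : ∀ k : ℕ, 6 * (k : K) - y ≠ 0)
    (ha : ∀ k : ℕ, 6 * (k : K) + y ≠ 0) (k : ℕ) : sixProd (y ^ 2) k ≠ 0 := by
  refine prod_ne_zero_iff.2 fun j _ => ?_
  have h1 := hs (j + 1)
  have h2 := ha (j + 1)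
  push_cast at h1 h2
  convert mul_ne_zero h1 h2 using 1
  ring

theorem sum_term_shift_sub (h2 : (2 : K) ≠ 0) {y : K} (hs : ∀ k : ℕ, 6 * (k : K) - y ≠ 0)
    (ha : ∀ k : ℕ, 6 * (k : K) + y ≠ 0) (h1 : y + 1 ≠ 0) (h3 : y + 3 ≠ 0) (h5 : y + 5 ≠ 0)
    (n : ℕ) :
    ∑ k ∈ range n, (term ((y + 6) ^ 2) k / (y + 6) - term (y ^ 2) k / y) = companion y n := by
  induction n with
  | zero => simp [companion]
  | succ k ih =>
    rw [sum_range_succ, ih]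
    have hy : y ≠ 0 := by simpa using ha 0
    have hy6 : y + 6 ≠ 0 := by simpa [add_comm] using ha 1
    have hD := sixProd_sq_ne_zero hs ha k
    have hk := hs k
    have hs1 := hs (k + 1)
    have ha1 := ha (k + 1)
    push_cast at hs1 ha1
    have h16 : (16 : K) ≠ 0 := by
      rw [show (16 : K) = 2 ^ 4 by norm_num]; exact pow_ne_zero _ h2
    -- Every product is expressed through its value at `y` and `k`, so the step becomes an identity
    -- of rational functions.
    have e1 : oddProd (y ^ 2) k = -(commonProd y k *
        ((2 * k - 5 - y) * (2 * k - 3 - y) * (2 * k - 1 - y))) / ((y + 1) * (y + 3) * (y + 5)) := by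
      rw [eq_div_iff (mul_ne_zero (mul_ne_zero h1 h3) h5)]
      linear_combination -oddProd_sq_mul y k
    have e2 : oddProd ((y + 6) ^ 2) k = commonProd y k *
        ((2 * k + 1 + y) * (2 * k + 3 + y) * (2 * k + 5 + y)) / ((y + 1) * (y + 3) * (y + 5)) := by
      rw [eq_div_iff (mul_ne_zero (mul_ne_zero h1 h3) h5)]
      exact oddProd_sq_shift_mul y k
    have e3 : sixProd ((y + 6) ^ 2) k =
        sixProd (y ^ 2) k * ((6 * (k + 1) + y) * (-y)) / ((y + 6) * (6 * k - y)) := by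
      rw [eq_div_iff (mul_ne_zero hy6 hk)]
      linear_combination sixProd_sq_shift_mul y k
    have e4 : commonProd y (k + 1) = commonProd y k * ((2 * k + 1 + y) * (2 * k - 5 - y)) := by
      rw [commonProd, prod_range_succ, ← commonProd]
    have e5 : sixProd (y ^ 2) (k + 1) =
        sixProd (y ^ 2) k * ((6 * (k + 1) - y) * (6 * (k + 1) + y)) := by
      rw [sixProd, prod_range_succ, ← sixProd]; ring
    simp only [term, companion, companion_coeff_succ h2, e1, e2, e3, e4, e5, pow_succ (16 : K)]
    generalize ((2 * k).centralBinom : K) = B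
    generalize commonProd y k = U
    generalize sixProd (y ^ 2) k = D at *
    push_cast
    have hp16 := pow_ne_zero k h16
    generalize (16 : K) ^ k = Q at *
    generalize (k : K) = k at *
    field_simp
    ring

end Telescoping

/-! ### Exact evaluation at u = p² -/

section OddIntegers

theorem companion_odd_natCast_eq_zero {m n : ℕ} (hm : Odd m) (hn : m + 5 < 2 * n) :
    companion (m : ℚ) n = 0 := by
  obtain ⟨i, rfl⟩ := hm
  have : commonProd ((2 * i + 1 : ℕ) : ℚ) n = 0 := by
    -- At j = i + 3 the factor 2j - 5 - y vanishes for y = 2i + 1.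
    refine prod_eq_zero (i := i + 3) (mem_range.2 (by omega)) ?_
    push_cast
    ring
  rw [companion, this, mul_zero, zero_div]

theorem sum_term_odd_shift {m n : ℕ} (hm : Odd m) (hn : m + 5 < 2 * n) :
    (∑ k ∈ range n, term (((m : ℚ) + 6) ^ 2) k) / (m + 6) =
      (∑ k ∈ range n, term ((m : ℚ) ^ 2) k) / m := by
  have hs (k : ℕ) : 6 * (k : ℚ) - m ≠ 0 := by
    rw [sub_ne_zero]
    norm_cast
    rintro rfl
    exact absurd hm (by simp [Nat.not_odd_iff_even, show Even 6 by decide])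
  have hm0 : (0 : ℚ) < m := by exact_mod_cast hm.pos
  have h := sum_term_shift_sub (by norm_num) hs (fun k => by positivity)
    (by positivity) (by positivity) (by positivity) n
  rwa [companion_odd_natCast_eq_zero hm hn, sum_sub_distrib, sub_eq_zero, ← sum_div,
    ← sum_div] at h

theorem sum_term_one {n : ℕ} (hn : 0 < n) : ∑ k ∈ range n, term (1 : ℚ) k = 1 := by
  rw [sum_eq_single_of_mem 0 (mem_range.2 hn)]
  · simp [term, oddProd, sixProd]
  · intro k _ hk
    have : oddProd (1 : ℚ) k = 0 :=
      prod_eq_zero (i := 0) (mem_range.2 (Nat.pos_of_ne_zero hk)) (by simp)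
    simp [term, this]

theorem sum_term_twentyFive {n : ℕ} (hn : 3 ≤ n) :
    ∑ k ∈ range n, term (25 : ℚ) k = -5 := by
  rw [← sum_subset (range_mono hn)]
  · norm_num [sum_range_succ, term, oddProd, sixProd, prod_range_succ, Nat.centralBinom,
      Nat.choose]
  · intro k _ hk
    have : oddProd (25 : ℚ) k = 0 :=
      prod_eq_zero (i := 2) (mem_range.2 (not_lt.1 fun h => hk (mem_range.2 (by omega)))) (by norm_num)
    simp [term, this]

theorem sum_term_six_mul_add_one (i : ℕ) {n : ℕ} (hn : 6 * i + 1 ≤ n) :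
    ∑ k ∈ range n, term (((6 * i + 1 : ℕ) : ℚ) ^ 2) k = (6 * i + 1 : ℕ) := by
  induction i with
  | zero => simpa using sum_term_one hn
  | succ i ih =>
    have h := sum_term_odd_shift (m := 6 * i + 1) (n := n) ⟨3 * i, by ring⟩ (by omega)
    rw [ih (by omega), div_self (by positivity), div_eq_one_iff_eq (by positivity)] at h
    rw [show ((6 * (i + 1) + 1 : ℕ) : ℚ) = (6 * i + 1 : ℕ) + 6 by push_cast; ring, h]

theorem sum_term_six_mul_add_five (i : ℕ) {n : ℕ} (hn : 6 * i + 5 ≤ n) :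
    ∑ k ∈ range n, term (((6 * i + 5 : ℕ) : ℚ) ^ 2) k = -(6 * i + 5 : ℕ) := by
  induction i with
  | zero =>
    have := sum_term_twentyFive (n := n) (by omega)
    norm_num
    exact this
  | succ i ih =>
    have h := sum_term_odd_shift (m := 6 * i + 5) (n := n) ⟨3 * i + 2, by ring⟩ (by omega)
    rw [ih (by omega), neg_div, div_self (by positivity), div_eq_iff (by positivity)] at h
    rw [show ((6 * (i + 1) + 5 : ℕ) : ℚ) = (6 * i + 5 : ℕ) + 6 by push_cast; ring, h]
    ring

theorem jacobiSym_neg_three {p : ℕ} (hp : Odd p) : jacobiSym (-3) p = jacobiSym p 3 := by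
  have h3 : jacobiSym (-3) p = ZMod.χ₄ p * jacobiSym 3 p := jacobiSym.neg 3 hp
  rw [h3, ZMod.χ₄_nat_mod_four]
  rcases Nat.odd_mod_four_iff.1 (Nat.odd_iff.1 hp) with h | h
  · have := jacobiSym.quadratic_reciprocity_one_mod_four (a := p) (b := 3) h (by decide)
    rw [h, this]
    simp
  · have := jacobiSym.quadratic_reciprocity_three_mod_four (a := p) (b := 3) h (by decide)
    rw [h, this]
    have : ZMod.χ₄ ((3 : ℕ) : ZMod 4) = -1 := by decide
    rw [this]
    simp

theorem sum_term_prime_sq {p : ℕ} (hp : p.Prime) (hp3 : 3 < p) :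
    ∑ k ∈ range p, term ((p : ℚ) ^ 2) k = p * (jacobiSym (-3) p : ℚ) := by
  have h2 : p % 2 ≠ 0 := fun h => by
    have := (Nat.prime_dvd_prime_iff_eq Nat.prime_two hp).1 (Nat.dvd_of_mod_eq_zero h); omega
  have h3 : p % 3 ≠ 0 := fun h => by
    have := (Nat.prime_dvd_prime_iff_eq Nat.prime_three hp).1 (Nat.dvd_of_mod_eq_zero h); omega
  rw [jacobiSym_neg_three (Nat.odd_iff.2 (by omega)), jacobiSym.mod_left]
  rcases (by omega : p % 6 = 1 ∨ p % 6 = 5) with h | h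
  · obtain ⟨i, rfl⟩ : ∃ i, p = 6 * i + 1 := ⟨p / 6, by omega⟩
    have hm : ((6 * i + 1 : ℕ) : ℤ) % (3 : ℕ) = 1 := by omega
    rw [sum_term_six_mul_add_one i le_rfl, hm]
    simp
  · obtain ⟨i, rfl⟩ : ∃ i, p = 6 * i + 5 := ⟨p / 6, by omega⟩
    have hm : ((6 * i + 5 : ℕ) : ℤ) % (3 : ℕ) = 2 := by omega
    have hj : jacobiSym 2 3 = -1 := by norm_num
    rw [sum_term_six_mul_add_five i le_rfl, hm, hj]
    push_cast
    ring

end OddIntegers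

/-! ### Clearing denominators: the sum as a polynomial in u -/

section Numerator

open Polynomial

/-- The numerator of `∑_{k ≤ n} term u k` over the common denominator `16ⁿ ∏_{j ≤ n} (36 j² - u)`. -/
def numerator {R : Type*} [CommRing R] (u : R) (n : ℕ) : R :=
  ∑ k ∈ range (n + 1), ((2 * k).centralBinom : R) * (8 * (k : R) + 1) * 16 ^ (n - k) *
    (oddProd u k * ∏ j ∈ Ico k n, (36 * ((j : R) + 1) ^ 2 - u))

theorem map_sixProd {R S : Type*} [CommRing R] [CommRing S] (f : R →+* S) (u : R) (n : ℕ) :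
    f (sixProd u n) = sixProd (f u) n := by
  simp [sixProd, map_prod, map_ofNat f]

theorem map_numerator {R S : Type*} [CommRing R] [CommRing S] (f : R →+* S) (u : R) (n : ℕ) :
    f (numerator u n) = numerator (f u) n := by
  simp [numerator, oddProd, map_sum, map_prod, map_ofNat f]

theorem numerator_eq {K : Type*} [Field K] (h2 : (2 : K) ≠ 0) {u : K} {n : ℕ}
    (hD : sixProd u n ≠ 0) :
    numerator u n = 16 ^ n * sixProd u n * ∑ k ∈ range (n + 1), term u k := by
  have h16 : (16 : K) ≠ 0 := by
    rw [show (16 : K) = 2 ^ 4 by norm_num]; exact pow_ne_zero _ h2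
  rw [numerator, mul_sum]
  refine sum_congr rfl fun k hk => ?_
  have hkn : k ≤ n := by simpa [Nat.lt_succ_iff] using hk
  have hsplit : sixProd u n = sixProd u k * ∏ j ∈ Ico k n, (36 * ((j : K) + 1) ^ 2 - u) :=
    (prod_range_mul_prod_Ico _ hkn).symm
  have hDk : sixProd u k ≠ 0 := left_ne_zero_of_mul (hsplit ▸ hD)
  have hpow : (16 : K) ^ n = 16 ^ k * 16 ^ (n - k) := by rw [← pow_add, Nat.add_sub_cancel' hkn]
  rw [hsplit, hpow, term]
  have := pow_ne_zero k h16
  field_simp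

theorem natDegree_prod_C_sub_sq_le {R : Type*} [CommRing R] (s : Finset ℕ) (f : ℕ → R) :
    (∏ j ∈ s, (C (f j) - X ^ 2 : R[X])).natDegree ≤ 2 * #s := by
  refine (natDegree_prod_le s _).trans ?_
  rw [mul_comm, ← smul_eq_mul]
  exact sum_le_card_nsmul s _ 2 fun j _ => by compute_degree

theorem natDegree_numerator_sq_le {R : Type*} [CommRing R] (n : ℕ) :
    (numerator (X ^ 2 : R[X]) n).natDegree ≤ 2 * n := by
  refine natDegree_sum_le_of_forall_le _ _ fun k hk => ?_
  have hkn : k ≤ n := by simpa [Nat.lt_succ_iff] using hk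
  have hodd : (oddProd (X ^ 2 : R[X]) k).natDegree ≤ 2 * k := by
    have h := natDegree_prod_C_sub_sq_le (range k) fun j => (2 * (j : R) + 1) ^ 2
    rw [card_range] at h
    convert h using 2
    simp [oddProd, map_ofNat (C : R →+* R[X])]
  have hsix : (∏ j ∈ Ico k n, (36 * ((j : R[X]) + 1) ^ 2 - X ^ 2)).natDegree ≤ 2 * (n - k) := by
    have h := natDegree_prod_C_sub_sq_le (Ico k n) fun j => 36 * ((j : R) + 1) ^ 2
    rw [Nat.card_Ico] at h
    convert h using 2
    simp [map_ofNat (C : R →+* R[X])]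
  have hcoeff : (((2 * k).centralBinom : R[X]) * (8 * (k : R[X]) + 1) * 16 ^ (n - k)) =
      C (((2 * k).centralBinom : R) * (8 * (k : R) + 1) * 16 ^ (n - k)) := by
    simp [map_ofNat (C : R →+* R[X])]
  rw [hcoeff]
  refine (natDegree_C_mul_le _ _).trans (natDegree_mul_le.trans ?_)
  omega

end Numerator

/-! ### Vanishing of the numerator polynomial modulo p -/

section ModPrime

open Polynomial

variable {p : ℕ}

/-- By Lucas: the last base-p digit of 2n, namely 2n - 3p, is smaller than that of n, namely n - p.
-/
theorem dvd_centralBinom (hp : p.Prime) {n : ℕ} (h1 : 3 * p ≤ 2 * n) (h2 : n < 2 * p) :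
    p ∣ n.centralBinom := by
  have := Fact.mk hp
  have h := Choose.choose_modEq_choose_mod_mul_choose_div_nat (n := 2 * n) (k := n) (p := p)
  have e1 : 2 * n % p = 2 * n - 3 * p := by
    rw [show 2 * n = (2 * n - 3 * p) + p * 3 by omega, Nat.add_mul_mod_self_left,
      Nat.mod_eq_of_lt (by omega)]
    omega
  have e2 : n % p = n - p := by
    conv_lhs => rw [show n = (n - p) + p * 1 by omega]
    rw [Nat.add_mul_mod_self_left, Nat.mod_eq_of_lt (by omega)]
  rw [e1, e2, Nat.choose_eq_zero_of_lt (by omega : 2 * n - 3 * p < n - p), zero_mul] at h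
  exact (Nat.modEq_zero_iff_dvd).1 h

theorem exists_six_mul_eq (hp : p.Prime) (hp3 : 3 < p) :
    ∃ a, 1 ≤ a ∧ 4 * a < p ∧ (6 * a = p + 1 ∨ 6 * a + 1 = p) := by
  have h2 : p % 2 ≠ 0 := fun h => by
    have := (Nat.prime_dvd_prime_iff_eq Nat.prime_two hp).1 (Nat.dvd_of_mod_eq_zero h); omega
  have h3 : p % 3 ≠ 0 := fun h => by
    have := (Nat.prime_dvd_prime_iff_eq Nat.prime_three hp).1 (Nat.dvd_of_mod_eq_zero h); omega
  exact ⟨(p + 1) / 6, by omega, by omega, by omega⟩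

/-- With 6a ≡ ±1 mod p, the factors 36j² - u at j = a and j = p - a both become 1 - u. Summands with
k < a contain both; those with a ≤ k < p - a contain one, plus 1 - u from `oddProd`; for k ≥ p - a
the binomial vanishes, since 4a < p. -/
theorem one_sub_sq_dvd_numerator {R : Type*} [CommRing R] [CharP R p] (hp : p.Prime)
    (hp3 : 3 < p) (u : R) : (1 - u) ^ 2 ∣ numerator u (p - 1) := by
  obtain ⟨a, ha1, hap, ha⟩ := exists_six_mul_eq hp hp3
  have ha36 : 36 * (a : R) ^ 2 = 1 := by
    have hp0 : (p : R) = 0 := CharP.cast_eq_zero R p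
    rcases ha with h | h <;> replace h := congrArg (Nat.cast : ℕ → R) h <;>
      push_cast [hp0] at h
    · linear_combination (6 * (a : R) + 1) * h
    · linear_combination (6 * (a : R) - 1) * h
  have ea : 36 * (((a - 1 : ℕ) : R) + 1) ^ 2 - u = 1 - u := by
    rw [Nat.cast_sub ha1]; push_cast; linear_combination ha36
  have eb : 36 * (((p - a - 1 : ℕ) : R) + 1) ^ 2 - u = 1 - u := by
    rw [Nat.sub_sub, Nat.cast_sub (by omega)]
    push_cast [CharP.cast_eq_zero R p]
    linear_combination ha36
  refine dvd_sum fun k hk => ?_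
  have hkp : k < p := by have := mem_range.1 hk; omega
  rcases lt_or_ge k a with hka | hka
  · refine Dvd.dvd.mul_left (Dvd.dvd.mul_left ?_ _) _
    have hsub : ({a - 1, p - a - 1} : Finset ℕ) ⊆ Ico k (p - 1) := by
      intro j hj
      simp only [mem_insert, mem_singleton] at hj
      rw [mem_Ico]
      omega
    have := prod_dvd_prod_of_subset _ _ (fun j : ℕ => 36 * ((j : R) + 1) ^ 2 - u) hsub
    rwa [prod_pair (by omega), ea, eb, ← sq] at this
  rcases lt_or_ge k (p - a) with hkb | hkb
  · rw [sq]
    refine Dvd.dvd.mul_left (mul_dvd_mul ?_ ?_) _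
    · rw [oddProd]
      have := dvd_prod_of_mem (fun j : ℕ => (2 * (j : R) + 1) ^ 2 - u)
        (mem_range.2 (by omega : 0 < k))
      simpa only [Nat.cast_zero, mul_zero, zero_add, one_pow] using this
    · rw [← eb]
      exact dvd_prod_of_mem (fun j : ℕ => 36 * ((j : R) + 1) ^ 2 - u) (mem_Ico.2 (by omega))
  · have hcb : ((2 * k).centralBinom : R) = 0 :=
      (CharP.cast_eq_zero_iff R p _).2 (dvd_centralBinom hp (by omega) (by omega))
    simp [hcb]

/-- The companion at n = p vanishes through its factor n. As p - 1 = -1 in `K`, the denominators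
satisfy (y + 6)² D((y + 6)²) = y² D(y²), which turns invariance of S(y²)/y into invariance of
y·N(y²). -/
theorem mul_numerator_shift {K : Type*} [Field K] [CharP K p] (hp : p.Prime) (hp3 : 3 < p)
    {y : K} (hy : ∀ m : ℤ, y ≠ m) :
    (y + 6) * numerator ((y + 6) ^ 2) (p - 1) = y * numerator (y ^ 2) (p - 1) := by
  have h2 : (2 : K) ≠ 0 := by
    have := (CharP.cast_eq_zero_iff K p 2).not.2
      (fun h => by have := Nat.le_of_dvd two_pos h; omega)
    simpa using this
  have hs {z : K} (hz : ∀ m : ℤ, z ≠ m) (k : ℕ) : 6 * (k : K) - z ≠ 0 := fun h =>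
    hz (6 * k) (by push_cast; linear_combination -h)
  have ha {z : K} (hz : ∀ m : ℤ, z ≠ m) (k : ℕ) : 6 * (k : K) + z ≠ 0 := fun h =>
    hz (-(6 * k)) (by push_cast; linear_combination h)
  have hc (m : ℤ) : y + m ≠ 0 := fun h => hy (-m) (by push_cast; linear_combination h)
  have hy6 (m : ℤ) : y + 6 ≠ m := fun h => hy (m - 6) (by push_cast; linear_combination h)
  have hp0 : (p : K) = 0 := CharP.cast_eq_zero K p
  have hp1 : ((p - 1 : ℕ) : K) = -1 := by
    rw [Nat.cast_sub (by omega), hp0]; simp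
  have hsum := sum_term_shift_sub h2 (hs hy) (ha hy) (by simpa using hc 1) (by simpa using hc 3)
    (by simpa using hc 5) p
  rw [show companion y p = 0 by simp [companion, CharP.cast_eq_zero], sum_sub_distrib, sub_eq_zero, ← sum_div,
    ← sum_div] at hsum
  have hshift := sixProd_sq_shift_mul y (p - 1)
  rw [hp1] at hshift
  rw [numerator_eq h2 (sixProd_sq_ne_zero (hs hy) (ha hy) _),
    numerator_eq h2 (sixProd_sq_ne_zero (hs hy6) (ha hy6) _), Nat.sub_add_cancel hp.one_le]
  have hy0 : y ≠ 0 := by simpa using hc 0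
  have hy60 : y + 6 ≠ 0 := by simpa using hc 6
  rw [div_eq_div_iff hy60 hy0] at hsum
  apply mul_left_cancel₀ (mul_ne_zero hy0 hy60)
  linear_combination 16 ^ (p - 1) * (y + 6) ^ 2 * sixProd ((y + 6) ^ 2) (p - 1) * hsum -
    16 ^ (p - 1) * (∑ k ∈ range p, term (y ^ 2) k) * (y + 6) * hshift

theorem eq_zero_of_sq_dvd {K ι : Type*} [Field K] [Fintype ι] {f : ι → K}
    (hf : Function.Injective f) {W : K[X]} (hW : ∀ i, (X - C (f i)) ^ 2 ∣ W)
    (hdeg : W.natDegree < 2 * Fintype.card ι) : W = 0 := by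
  have hprod : ∏ i, (X - C (f i)) ^ 2 ∣ W :=
    Fintype.prod_dvd_of_coprime (fun i j hij => (pairwise_coprime_X_sub_C hf hij).pow) hW
  refine eq_zero_of_dvd_of_natDegree_lt hprod ?_
  rw [natDegree_prod_of_monic _ _ fun i _ => (monic_X_sub_C _).pow 2]
  simpa [mul_comm] using hdeg

theorem numerator_sq_eq_zero {K : Type*} [Field K] [Infinite K] [CharP K p] (hp : p.Prime)
    (hp3 : 3 < p) : numerator (X ^ 2 : K[X]) (p - 1) = 0 := by
  have := Fact.mk hp
  obtain ⟨W, hW⟩ : ∃ W : K[X], W = X * numerator (X ^ 2 : K[X]) (p - 1) := ⟨_, rfl⟩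
  have hcomp (q : K[X]) : W.comp q = q * numerator (q ^ 2) (p - 1) := by
    rw [hW, mul_comp, X_comp, ← coe_compRingHom_apply, map_numerator]; simp
  have heval (y : K) : W.eval y = y * numerator (y ^ 2) (p - 1) := by
    rw [hW, eval_mul, eval_X, ← coe_evalRingHom, map_numerator]; simp
  have hfin : (Set.range (ZMod.castHom dvd_rfl K : ZMod p →+* K)).Finite := Set.finite_range _
  have hinv : W.comp (X + C 6) = W := by
    -- The shift identity is available off the finite prime field, which suffices as `K` is
    -- infinite.
    refine eq_of_infinite_eval_eq _ _ (hfin.infinite_compl.mono fun y hy => ?_)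
    have hy' (m : ℤ) : y ≠ m := fun h => hy ⟨m, by rw [map_intCast, h]⟩
    rw [Set.mem_ofPred_eq, eval_comp, heval, heval]
    simpa using mul_numerator_shift hp hp3 hy'
  have hone : (X - C 1) ^ 2 ∣ W := by
    have h := one_sub_sq_dvd_numerator (p := p) hp hp3 (X ^ 2 : K[X])
    rw [hW]
    refine Dvd.dvd.mul_left (dvd_trans (pow_dvd_pow_of_dvd ⟨-(X + 1), ?_⟩ 2) h) X
    simp only [map_one]
    ring
  have hiter (i : ℕ) : (X - C (1 - 6 * (i : K))) ^ 2 ∣ W := by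
    induction i with
    | zero => simpa using hone
    | succ i ih =>
      obtain ⟨q, hq⟩ := ih
      refine ⟨q.comp (X + C 6), ?_⟩
      conv_lhs => rw [← hinv, hq]
      simp only [mul_comp, pow_comp, sub_comp, X_comp, C_comp]
      congr 2
      simp
      ring
  have h6 : (6 : ZMod p) ≠ 0 := by
    have : ((6 : ℕ) : ZMod p) ≠ 0 := (ZMod.natCast_eq_zero_iff 6 p).not.2 fun h => by
      have h23 : p ∣ 2 * 3 := h
      rcases hp.dvd_mul.1 h23 with h | h <;> have := Nat.le_of_dvd (by norm_num) h <;> omega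
    exact_mod_cast this
  have hall (c : ZMod p) : (X - C (ZMod.castHom dvd_rfl K c)) ^ 2 ∣ W := by
    -- As 6 is invertible mod p, shifts by 6 starting from 1 reach every residue.
    have hc : c = 1 - 6 * ((((1 - c) / 6).val : ℕ) : ZMod p) := by
      rw [ZMod.natCast_zmod_val]; field_simp; ring
    generalize ((1 - c) / 6).val = i at hc
    subst hc
    rw [map_sub, map_mul, map_one, map_ofNat, map_natCast]
    exact hiter i
  have hdeg : W.natDegree ≤ 1 + 2 * (p - 1) := hW ▸
    natDegree_mul_le.trans (add_le_add natDegree_X_le (natDegree_numerator_sq_le _))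
  have hlt : W.natDegree < 2 * Fintype.card (ZMod p) := by
    have := hp.pos
    rw [ZMod.card]
    omega
  have hinj := (ZMod.castHom (dvd_refl p) K).injective
  have hW0 : W = 0 := eq_zero_of_sq_dvd hinj hall hlt
  exact (mul_eq_zero.1 (hW.symm.trans hW0)).resolve_left X_ne_zero

theorem C_dvd_numerator (hp : p.Prime) (hp3 : 3 < p) :
    C (p : ℤ) ∣ numerator (X : ℤ[X]) (p - 1) := by
  have := Fact.mk hp
  let K := AlgebraicClosure (ZMod p)
  have : CharP K p := charP_of_injective_algebraMap (algebraMap (ZMod p) K).injective p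
  have : Infinite K := IsAlgClosed.instInfinite
  have h0 : numerator (X : K[X]) (p - 1) = 0 := by
    -- The substitution X → X² is injective, so vanishing at `X ^ 2` is enough.
    rw [← expand_eq_zero (R := K) two_pos]
    have := map_numerator (expand K 2 : K[X] →+* K[X]) (X : K[X]) (p - 1)
    simpa [numerator_sq_eq_zero hp hp3] using this
  have hmap : (numerator (X : ℤ[X]) (p - 1)).map (Int.castRingHom K) = 0 := by
    rw [← coe_mapRingHom, map_numerator]; simpa using h0
  rw [C_dvd_iff_dvd_coeff]
  intro i
  have := congrArg (fun q => coeff q i) hmap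
  rw [coeff_map, coeff_zero, eq_intCast] at this
  exact (CharP.intCast_eq_zero_iff K p _).1 this

/-- Writing N = pQ, one p comes from the content and p² from Q(p²) - Q(0). -/
theorem cube_dvd_numerator_sub (hp : p.Prime) (hp3 : 3 < p) :
    (p : ℤ) ^ 3 ∣ numerator ((p : ℤ) ^ 2) (p - 1) - numerator (0 : ℤ) (p - 1) := by
  obtain ⟨Q, hQ⟩ := C_dvd_numerator hp hp3
  have heval (a : ℤ) : numerator a (p - 1) = p * Q.eval a := by
    have := congrArg (eval a) hQ
    rwa [← coe_evalRingHom, map_numerator, coe_evalRingHom, eval_X, eval_mul, eval_C] at this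
  have h := sub_dvd_eval_sub ((p : ℤ) ^ 2) 0 Q
  rw [sub_zero] at h
  rw [heval, heval, ← mul_sub, pow_succ']
  exact mul_dvd_mul_left _ h

theorem sq_dvd_sixProd_sub (a : ℤ) (n : ℕ) :
    a ^ 2 ∣ sixProd (a ^ 2) n - sixProd (0 : ℤ) n := by
  have h := sub_dvd_eval_sub (a ^ 2) 0 (sixProd (X : ℤ[X]) n)
  simp only [← coe_evalRingHom, map_sixProd] at h
  simpa using h

end ModPrime

/-! ### Identification of the original summand, and the conclusion modulo p³ -/

theorem pochhammer_succ (a : ℚ) (k : ℕ) : pochhammer a (k + 1) = pochhammer a k * (a + k) :=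
  prod_range_succ _ _

theorem pochhammer_div_eq_term (k : ℕ) :
    pochhammer (1 / 4) k * pochhammer (1 / 2) k * pochhammer (3 / 4) k /
      ((k.factorial : ℚ) ^ 3 * 9 ^ k) * (8 * (k : ℚ) + 1) = term 0 k := by
  have h : pochhammer (1 / 4) k * pochhammer (1 / 2) k * pochhammer (3 / 4) k /
      ((k.factorial : ℚ) ^ 3 * 9 ^ k) =
      ((2 * k).centralBinom : ℚ) * oddProd 0 k / (16 ^ k * sixProd 0 k) := by
    induction k with
    | zero => simp [pochhammer, oddProd, sixProd]
    | succ k ih =>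
      have hcb := congrArg (Nat.cast : ℕ → ℚ) (centralBinom_two_mul_succ k)
      push_cast at hcb
      have hcb' : ((2 * (k + 1)).centralBinom : ℚ) =
          4 * (4 * k + 1) * (4 * k + 3) * (2 * k).centralBinom / ((2 * k + 1) * (2 * k + 2)) := by
        rw [eq_div_iff (by positivity)]
        linear_combination hcb
      have ho : oddProd (0 : ℚ) (k + 1) = oddProd 0 k * (2 * k + 1) ^ 2 := by
        rw [oddProd, prod_range_succ, ← oddProd, sub_zero]
      have hs : sixProd (0 : ℚ) (k + 1) = sixProd 0 k * (36 * (k + 1) ^ 2) := by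
        rw [sixProd, prod_range_succ, ← sixProd, sub_zero]
      rw [pochhammer_succ, pochhammer_succ, pochhammer_succ, hcb', ho, hs, Nat.factorial_succ,
        pow_succ (9 : ℚ), pow_succ (16 : ℚ)]
      push_cast
      -- Isolating the ratio of consecutive summands lets the induction hypothesis be rewritten.
      trans (pochhammer (1 / 4) k * pochhammer (1 / 2) k * pochhammer (3 / 4) k /
        ((k.factorial : ℚ) ^ 3 * 9 ^ k)) *
          ((1 / 4 + k) * (1 / 2 + k) * (3 / 4 + k) / (9 * (k + 1) ^ 3))
      · field_simp
      · rw [ih]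
        have : sixProd (0 : ℚ) k ≠ 0 := prod_ne_zero_iff.2 fun j _ => by
          rw [sub_zero]; positivity
        field_simp
        ring
  rw [h, term]
  ring

theorem not_dvd_sixProd_zero {p : ℕ} (hp : p.Prime) (hp3 : 3 < p) {n : ℕ} (hn : n < p) :
    ¬(p : ℤ) ∣ 16 ^ n * sixProd (0 : ℤ) n := by
  have hpi := Nat.prime_iff_prime_int.1 hp
  have hsmall {m : ℕ} (hm : 0 < m) (hmp : m < p) : ¬(p : ℤ) ∣ m := fun h =>
    absurd (Nat.le_of_dvd hm (Int.natCast_dvd_natCast.1 h)) (by omega)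
  have h2 : ¬(p : ℤ) ∣ 2 := hsmall (m := 2) two_pos (by omega)
  have h3 : ¬(p : ℤ) ∣ 3 := hsmall (m := 3) three_pos hp3
  rw [hpi.dvd_mul, not_or]
  constructor
  · rw [show (16 : ℤ) = 2 ^ 4 by norm_num, ← pow_mul]
    exact fun h => h2 (hpi.dvd_of_dvd_pow h)
  · rw [sixProd, hpi.dvd_finsetProd_iff]
    rintro ⟨j, hj, hd⟩
    have hj' : ¬(p : ℤ) ∣ (j : ℤ) + 1 := by
      exact_mod_cast hsmall j.succ_pos (by have := mem_range.1 hj; omega)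
    rw [sub_zero, show 36 * ((j : ℤ) + 1) ^ 2 = (2 * 3 * (j + 1)) ^ 2 by ring] at hd
    rcases hpi.dvd_mul.1 (hpi.dvd_of_dvd_pow hd) with h | h
    · exact (hpi.dvd_mul.1 h).elim h2 h3
    · exact hj' h

end RamanujanNine

open RamanujanNine in
theorem theorem2 (p : ℕ) (hp : p.Prime) (hp3 : 3 < p) :
    RatModEq (p ^ 3)
      (∑ k ∈ Finset.range p,
        pochhammer (1 / 4) k * pochhammer (1 / 2) k * pochhammer (3 / 4) k /
          ((k.factorial : ℚ) ^ 3 * 9 ^ k) * (8 * (k : ℚ) + 1))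
      ((p : ℚ) * (jacobiSym (-3) p : ℚ)) := by
  simp only [pochhammer_div_eq_term]
  set J : ℤ := jacobiSym (-3) p
  have hp1 : p - 1 + 1 = p := Nat.sub_add_cancel hp.one_le
  have hunit := not_dvd_sixProd_zero hp hp3 (n := p - 1) (by omega)
  set d : ℤ := 16 ^ (p - 1) * sixProd (0 : ℤ) (p - 1) with hd
  have hd0 : (d : ℚ) ≠ 0 := by
    norm_cast
    rintro h
    exact hunit (h ▸ dvd_zero _)
  have hcast (u : ℤ) : ((sixProd u (p - 1) : ℤ) : ℚ) = sixProd (u : ℚ) (p - 1) := by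
    simpa using map_sixProd (Int.castRingHom ℚ) u (p - 1)
  have hcastN (u : ℤ) : ((numerator u (p - 1) : ℤ) : ℚ) = numerator (u : ℚ) (p - 1) := by
    simpa using map_numerator (Int.castRingHom ℚ) u (p - 1)
  have hzero : ((numerator (0 : ℤ) (p - 1) : ℤ) : ℚ) = d * ∑ k ∈ Finset.range p, term (0 : ℚ) k := by
    have hs := hcast 0
    rw [Int.cast_zero] at hs
    have hne : sixProd (0 : ℚ) (p - 1) ≠ 0 := by
      rw [← hs]
      exact fun h => hd0 (by rw [hd, Int.cast_mul, h, mul_zero])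
    rw [hcastN, Int.cast_zero, numerator_eq two_ne_zero hne, hp1, hd]
    push_cast
    rw [hs]
  have hsq : numerator ((p : ℤ) ^ 2) (p - 1) =
      16 ^ (p - 1) * sixProd ((p : ℤ) ^ 2) (p - 1) * (p * J) := by
    have hodd : p % 2 = 1 := hp.mod_two_eq_one_iff_ne_two.2 (by omega)
    have hne : sixProd ((p : ℚ) ^ 2) (p - 1) ≠ 0 := by
      refine sixProd_sq_ne_zero (fun k => ?_) (fun k => ?_) _
      · rw [sub_ne_zero]
        norm_cast
        omega
      · have := hp.pos
        positivity
    have hs := hcast ((p : ℤ) ^ 2)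
    push_cast at hs
    have h := hcastN ((p : ℤ) ^ 2)
    push_cast at h
    rw [numerator_eq two_ne_zero hne, hp1, sum_term_prime_sq hp hp3, ← hs] at h
    exact_mod_cast h
  obtain ⟨s, hs⟩ := cube_dvd_numerator_sub hp hp3
  obtain ⟨t, ht⟩ := sq_dvd_sixProd_sub (p : ℤ) (p - 1)
  have hint : numerator (0 : ℤ) (p - 1) - d * (p * J) =
      (p : ℤ) ^ 3 * (16 ^ (p - 1) * t * J - s) := by
    rw [hd]
    linear_combination hsq - hs + 16 ^ (p - 1) * p * J * ht
  set z : ℤ := 16 ^ (p - 1) * t * J - s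
  -- The denominator of z/d divides `d`, which is prime to p.
  refine ⟨Rat.divInt z d, ?_, ?_⟩
  · refine Nat.Coprime.pow_right _ (Nat.Coprime.symm ((hp.coprime_iff_not_dvd).2 fun h => ?_))
    exact hunit ((Int.natCast_dvd_natCast.2 h).trans (Rat.den_dvd z d))
  · rw [Rat.divInt_eq_div]
    have hq := congrArg (Int.cast : ℤ → ℚ) hint
    push_cast at hq ⊢
    rw [hzero] at hq
    field_simp
    linear_combination hq
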